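/- **Theorem.** Let $\mathbb D=\{|z|<1\}$. Let $\alpha_1,\gamma_1,\alpha_2,\gamma_2>0$, $\beta_1,\delta_1,\beta_2,\delta_2\ge 0$ with $\beta_j+\delta_j>0$ for $j=1,2$, and let $\sigma\in\mathbb C$, $|\sigma|<1$. For $j=1,2$ let $$W_j(z)=z\,\Gamma(\alpha_j)\Gamma(\gamma_j)\sum_{n=0}^\infty \frac{z^n}{\Gamma(\alpha_j+n\beta_j)\,\Gamma(\gamma_j+n\delta_j)}$$ be the normalized four-parameter Wright function. Let $f=h+\overline g$ be a normalized harmonic mapping of $\mathbb D$, i.e. $h(z)=z+\sum_{n\ge2}A_nz^n$ and $g(z)=\sum_{n\ge1}B_nz^n$ are analytic in $\mathbb D$ and $|B_1|<1$. Put $$H(z)=z+\sum_{n=2}^\infty\frac{\Gamma(\alpha_1)\Gamma(\gamma_1)A_nz^n}{\Gamma(\alpha_1+(n-1)\beta_1)\Gamma(\gamma_1+(n-1)\delta_1)},\qquad G(z)=\sum_{n=1}^\infty\frac{\Gamma(\alpha_2)\Gamma(\gamma_2)B_nz^n}{\Gamma(\alpha_2+(n-1)\beta_2)\Gamma(\gamma_2+(n-1)\delta_2)},$$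 and $L(f)=H+\overline{\sigma G}$. If (i) $\sum_{n=2}^\infty n|A_n|+\sum_{n=1}^\infty n|B_n|\le 1$, and (ii) $W_1(1)+W_2(1)-2\le 1-|B_1|$, then $L(f)$ is a harmonic close-to-convex mapping, and so is $H+\overline G$. Here $F$ is called a harmonic close-to-convex mapping (a member of $C_{\hat H}$) if on $\mathbb D$ it is a normalized harmonic mapping $F=P+\overline Q$ (in the above sense) which is sense-preserving ($|P'|>|Q'|$ in $\mathbb D$) and univalent in $\mathbb D$, and $F(\mathbb D)$ is a close-to-convex domain, i.e. a domain whose complement is a union of non-crossing closed half-lines (pairwise disjoint, except that the origin of one may lie on another). -/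

import Mathlib

open Metric
open scoped ComplexConjugate

/-- The open unit disk. -/
def unitDisk : Set ℂ := ball (0 : ℂ) 1

/-- The `n`-th Taylor coefficient of `p` at the origin. -/
noncomputable def taylorCoeff (p : ℂ → ℂ) (n : ℕ) : ℂ :=
  iteratedDeriv n p 0 / (n.factorial : ℂ)

/-- `f = h + conj g` on the unit disk, where `h` and `g` are analytic there,
`h(z) = z + ∑_{n ≥ 2} Aₙ zⁿ`, `g(z) = ∑_{n ≥ 1} Bₙ zⁿ` and `|B₁| < 1`:
`f` is a normalized harmonic mapping with analytic part `h` and co-analytic part `g`. -/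
structure IsNormalizedHarmonic (f h g : ℂ → ℂ) : Prop where
  analytic_h : AnalyticOnNhd ℂ h unitDisk
  analytic_g : AnalyticOnNhd ℂ g unitDisk
  h_zero : h 0 = 0
  deriv_h_zero : deriv h 0 = 1
  g_zero : g 0 = 0
  norm_deriv_g_zero : ‖deriv g 0‖ < 1
  eqOn : Set.EqOn f (fun z => h z + conj (g z)) unitDisk

/-- The class of normalized harmonic mappings that are sense-preserving (positive Jacobian
`|h'|² - |g'|²`) and univalent in the unit disk. -/
def ClassSH : Set (ℂ → ℂ) :=
  {f | ∃ h g : ℂ → ℂ, IsNormalizedHarmonic f h g ∧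
    (∀ z ∈ unitDisk, ‖deriv g z‖ < ‖deriv h z‖) ∧ Set.InjOn f unitDisk}

/-- The closed half-line with origin `r.1` and direction `r.2`. -/
def closedHalfLine (r : ℂ × ℂ) : Set ℂ := {w | ∃ t : ℝ, 0 ≤ t ∧ w = r.1 + (t : ℂ) * r.2}

/-- The open half-line with origin `r.1` and direction `r.2`. -/
def openHalfLine (r : ℂ × ℂ) : Set ℂ := {w | ∃ t : ℝ, 0 < t ∧ w = r.1 + (t : ℂ) * r.2}

/-- A domain is close-to-convex if its complement is a union of non-crossing closed half-lines:
the half-lines are pairwise disjoint, except that the origin of one may lie on another. -/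
def IsCloseToConvexDomain (Ω : Set ℂ) : Prop :=
  IsOpen Ω ∧ IsConnected Ω ∧
    ∃ R : Set (ℂ × ℂ), (∀ r ∈ R, r.2 ≠ 0) ∧ Ωᶜ = ⋃ r ∈ R, closedHalfLine r ∧
      R.PairwiseDisjoint openHalfLine

/-- The class of harmonic close-to-convex mappings. -/
def ClassCH : Set (ℂ → ℂ) :=
  {f | f ∈ ClassSH ∧ IsCloseToConvexDomain (f '' unitDisk)}

/-- The four-parameter Wright function `∑ zⁿ / (Γ(α + nβ) Γ(γ + nδ))`. -/
noncomputable def wright (α β γ δ : ℝ) (z : ℂ) : ℂ :=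
  ∑' n : ℕ, z ^ n / ((Real.Gamma (α + n * β) * Real.Gamma (γ + n * δ) : ℝ) : ℂ)

/-- The normalized four-parameter Wright function `W(z) = z Γ(α) Γ(γ) ∑ zⁿ / (Γ(α+nβ) Γ(γ+nδ))`. -/
noncomputable def normalizedWright (α β γ δ : ℝ) (z : ℂ) : ℂ :=
  z * ((Real.Gamma α * Real.Gamma γ : ℝ) : ℂ) * wright α β γ δ z

/-- The convolution (Hadamard product) `p * W` of `p(z) = ∑_{n ≥ 1} pₙ zⁿ` with the normalized
Wright function:
`∑_{n ≥ 1} Γ(α) Γ(γ) pₙ zⁿ / (Γ(α + (n-1)β) Γ(γ + (n-1)δ))`; here `n` is shifted by one. -/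
noncomputable def wrightConv (α β γ δ : ℝ) (p : ℂ → ℂ) (z : ℂ) : ℂ :=
  ∑' n : ℕ, ((Real.Gamma α * Real.Gamma γ /
    (Real.Gamma (α + n * β) * Real.Gamma (γ + n * δ)) : ℝ) : ℂ) * taylorCoeff p (n + 1) * z ^ (n + 1)

/-- The operator `L(f) = h * W₁ + conj (σ (g * W₂))` for `f = h + conj g`. -/
noncomputable def wrightOperator (α₁ β₁ γ₁ δ₁ α₂ β₂ γ₂ δ₂ : ℝ) (σ : ℂ) (h g : ℂ → ℂ) (z : ℂ) : ℂ :=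
  wrightConv α₁ β₁ γ₁ δ₁ h z + conj (σ * wrightConv α₂ β₂ γ₂ δ₂ g z)

/-!
Condition (i) gives `n |Aₙ| ≤ 1` and `n |Bₙ| ≤ 1`, so the weighted coefficients of `H` and `σ G` are
dominated by the coefficients of `W₁` and `W₂`, and (ii) becomes `∑ n |cₙ| + ∑ n |bₙ| ≤ 2` for
`F = ∑ cₙ zⁿ + conj (∑ bₙ zⁿ)` with `c₁ = 1`.

For `|z| ≤ |ζ| ≤ r ≤ 1` and `0 ≤ t ≤ 1` one has `|ζⁿ - t zⁿ| ≤ n rⁿ⁻¹ |ζ - t z|`. Summing over `n`,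
`|(F ζ - ζ) - t (F z - z)| ≤ K |ζ - t z|` with `K < 1` as soon as `r < 1`. For `t = 1` this makes `F`
a Lipschitz perturbation of the identity, hence injective and open. For general `t` it shows that
`F ζ = t F z` forces `|ζ| ≤ |z|`, so that a segment from `F z` to `0` cannot leave the image of the
disk: the image is starlike, and its complement is a union of radial half-lines.
-/

open Set Filter Topology

section StarLipschitz

variable {E F G : Type*} [NormedAddCommGroup E] [NormedSpace ℝ E]
  [NormedAddCommGroup F] [NormedSpace ℝ F] [NormedAddCommGroup G] [NormedSpace ℝ G]

/-- `T` is star-Lipschitz on `s` with constant `K` if `‖T ζ - t T z‖ ≤ K ‖ζ - t z‖` whenever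
`‖z‖ ≤ ‖ζ‖` and `t ∈ [0, 1]`. The Lipschitz property is the case `t = 1`; the other values of `t`
control the position of `T ζ` relative to the segment from `0` to `T z`. -/
def StarLipschitzOn (K : ℝ) (T : E → F) (s : Set E) : Prop :=
  ∀ ⦃ζ⦄, ζ ∈ s → ∀ ⦃z⦄, z ∈ s → ‖z‖ ≤ ‖ζ‖ → ∀ ⦃t : ℝ⦄, 0 ≤ t → t ≤ 1 →
    ‖T ζ - t • T z‖ ≤ K * ‖ζ - t • z‖

namespace StarLipschitzOn

variable {K L : ℝ} {T S : E → F} {s : Set E}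

lemma lipschitzOnWith (hT : StarLipschitzOn K T s) : LipschitzOnWith K.toNNReal T s := by
  refine LipschitzOnWith.of_dist_le' fun ζ hζ z hz => ?_
  rcases le_total ‖z‖ ‖ζ‖ with hle | hle
  · simpa [dist_eq_norm] using hT hζ hz hle zero_le_one le_rfl
  · simpa [dist_eq_norm, norm_sub_rev] using hT hz hζ hle zero_le_one le_rfl

lemma add (hT : StarLipschitzOn K T s) (hS : StarLipschitzOn L S s) :
    StarLipschitzOn (K + L) (fun z => T z + S z) s := by
  intro ζ hζ z hz hle t ht0 ht1
  calc ‖T ζ + S ζ - t • (T z + S z)‖ = ‖(T ζ - t • T z) + (S ζ - t • S z)‖ := by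
        rw [smul_add, add_sub_add_comm]
    _ ≤ ‖T ζ - t • T z‖ + ‖S ζ - t • S z‖ := norm_add_le _ _
    _ ≤ K * ‖ζ - t • z‖ + L * ‖ζ - t • z‖ :=
        add_le_add (hT hζ hz hle ht0 ht1) (hS hζ hz hle ht0 ht1)
    _ = (K + L) * ‖ζ - t • z‖ := (add_mul _ _ _).symm

lemma linearIsometry_comp (hT : StarLipschitzOn K T s) (φ : F →ₗᵢ[ℝ] G) :
    StarLipschitzOn K (fun z => φ (T z)) s := by
  intro ζ hζ z hz hle t ht0 ht1
  rw [← map_smul, ← map_sub, φ.norm_map]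
  exact hT hζ hz hle ht0 ht1

lemma hasSum {ι : Type*} {K : ι → ℝ} {T : ι → E → F}
    (hT : ∀ i, StarLipschitzOn (K i) (T i) s) (hK : HasSum K L)
    (hS : ∀ z ∈ s, HasSum (fun i => T i z) (S z)) : StarLipschitzOn L S s :=
  fun ζ hζ z hz hle t ht0 ht1 =>
    ((hS ζ hζ).sub ((hS z hz).const_smul t)).norm_le_of_bounded (hK.mul_right _)
      fun i => hT i hζ hz hle ht0 ht1

end StarLipschitzOn

lemma image_mem_nhds_of_lipschitzOnWith_sub_id [CompleteSpace E] {f : E → E} {s : Set E} {z : E}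
    {K : NNReal} (hf : LipschitzOnWith K (fun z => f z - z) s) (hK : K < 1) (hs : s ∈ 𝓝 z) :
    f '' s ∈ 𝓝 (f z) := by
  have happrox : ApproximatesLinearOn f (ContinuousLinearEquiv.refl ℝ E : E →L[ℝ] E) s K :=
    ApproximatesLinearOn.approximatesLinearOn_iff_lipschitzOnWith.2 hf
  refine happrox.image_mem_nhds (ContinuousLinearEquiv.refl ℝ E).toNonlinearRightInverse hs ?_
  rcases subsingleton_or_nontrivial E with hE | hE
  · exact .inl hE
  · have hid : (ContinuousLinearEquiv.refl ℝ E).toNonlinearRightInverse.nnnorm = 1 :=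
      ContinuousLinearMap.nnnorm_id
    exact .inr (by rwa [hid, inv_one])

section PerturbationOfIdentity

variable {f : E → E} {R : ℝ}
  (hf : ∀ r, 0 ≤ r → r < R → ∃ K < 1, StarLipschitzOn K (fun z => f z - z) (closedBall 0 r))

include hf

lemma eq_smul_of_apply_eq_smul_apply {ζ z : E} (hζ : ζ ∈ ball 0 R) (hle : ‖z‖ ≤ ‖ζ‖) {t : ℝ}
    (ht0 : 0 ≤ t) (ht1 : t ≤ 1) (h : f ζ = t • f z) : ζ = t • z := by
  obtain ⟨K, hK, hstar⟩ := hf ‖ζ‖ (norm_nonneg ζ) (mem_ball_zero_iff.1 hζ)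
  have hdiff : f ζ - ζ - t • (f z - z) = -(ζ - t • z) := by rw [h, smul_sub]; abel
  have hbound := hstar (by simp) (by simpa using hle) hle ht0 ht1
  rw [hdiff, norm_neg] at hbound
  refine sub_eq_zero.1 (norm_le_zero_iff.1 ?_)
  nlinarith

lemma injOn_ball_of_starLipschitzOn_sub_id : InjOn f (ball 0 R) := by
  intro ζ hζ z hz h
  rcases le_total ‖z‖ ‖ζ‖ with hle | hle
  · simpa using eq_smul_of_apply_eq_smul_apply hf hζ hle zero_le_one le_rfl (by simpa using h)
  · simpa using
      (eq_smul_of_apply_eq_smul_apply hf hz hle zero_le_one le_rfl (by simpa using h.symm)).symm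

lemma exists_lipschitzOnWith_sub_id {z : E} (hz : z ∈ ball 0 R) :
    ∃ K < 1, ∃ s ∈ 𝓝 z, s ⊆ ball 0 R ∧ LipschitzOnWith K (fun z => f z - z) s := by
  obtain ⟨r, hzr, hrR⟩ := exists_between (mem_ball_zero_iff.1 hz)
  obtain ⟨K, hK, hstar⟩ := hf r ((norm_nonneg z).trans hzr.le) hrR
  exact ⟨K.toNNReal, Real.toNNReal_lt_one.2 hK, closedBall 0 r,
    closedBall_mem_nhds_of_mem (mem_ball_zero_iff.2 hzr), closedBall_subset_ball hrR,
    hstar.lipschitzOnWith⟩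

lemma isOpen_image_ball_of_starLipschitzOn_sub_id [CompleteSpace E] : IsOpen (f '' ball 0 R) := by
  refine isOpen_iff_mem_nhds.2 (forall_mem_image.2 fun z hz => ?_)
  obtain ⟨K, hK, s, hs, hsR, hlip⟩ := exists_lipschitzOnWith_sub_id hf hz
  exact mem_of_superset (image_mem_nhds_of_lipschitzOnWith_sub_id hlip hK hs) (image_mono hsR)

lemma continuousOn_ball_of_starLipschitzOn_sub_id : ContinuousOn f (ball 0 R) := by
  intro z hz
  obtain ⟨K, -, s, hs, -, hlip⟩ := exists_lipschitzOnWith_sub_id hf hz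
  have hcont : ContinuousAt (fun z => f z - z + z) z :=
    (hlip.continuousOn.continuousAt hs).add continuousAt_id
  simpa using hcont.continuousWithinAt

lemma norm_le_of_apply_eq_smul_apply {ζ z : E} (hζ : ζ ∈ ball 0 R) {t : ℝ}
    (ht0 : 0 ≤ t) (ht1 : t ≤ 1) (h : f ζ = t • f z) : ‖ζ‖ ≤ ‖z‖ := by
  by_contra! hlt
  have heq := eq_smul_of_apply_eq_smul_apply hf hζ hlt.le ht0 ht1 h
  refine hlt.not_ge ?_
  rw [heq, norm_smul, Real.norm_of_nonneg ht0]
  exact mul_le_of_le_one_left (norm_nonneg z) ht1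

-- On the segment from `0` to `f z`, membership in the open set `f '' ball 0 R` coincides with
-- membership in the compact set `f '' closedBall 0 ‖z‖`, so connectedness decides.
lemma starConvex_image_ball_of_starLipschitzOn_sub_id [ProperSpace E] :
    StarConvex ℝ 0 (f '' ball 0 R) := by
  refine starConvex_iff_segment_subset.2 (forall_mem_image.2 fun z hz => ?_)
  have hsub : closedBall 0 ‖z‖ ⊆ ball (0 : E) R := closedBall_subset_ball (mem_ball_zero_iff.1 hz)
  have hclosed : IsClosed (f '' closedBall 0 ‖z‖) :=
    ((isCompact_closedBall _ _).image_of_continuousOn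
      ((continuousOn_ball_of_starLipschitzOn_sub_id hf).mono hsub)).isClosed
  have hseg : ∀ w ∈ segment ℝ 0 (f z), w ∈ f '' ball 0 R → w ∈ f '' closedBall 0 ‖z‖ := by
    rintro _ hw ⟨ζ, hζ, rfl⟩
    rw [segment_eq_image] at hw
    obtain ⟨t, ht, h⟩ := hw
    simp only [smul_zero, zero_add] at h
    exact ⟨ζ, mem_closedBall_zero_iff.2
      (norm_le_of_apply_eq_smul_apply hf hζ ht.1 ht.2 h.symm), rfl⟩
  rcases isPreconnected_iff_subset_of_disjoint.1 (convex_segment 0 (f z)).isPreconnected _ _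
    (isOpen_image_ball_of_starLipschitzOn_sub_id hf) hclosed.isOpen_compl
    (fun w _ => or_iff_not_imp_left.2 fun hw hw' => hw (image_mono hsub hw'))
    (eq_empty_of_forall_notMem fun w ⟨hw, hwU, hwK⟩ => hwK (hseg w hw hwU)) with hU | hK
  · exact hU
  · exact absurd (mem_image_of_mem f (by simp)) (hK (right_mem_segment ℝ 0 (f z)))

end PerturbationOfIdentity

end StarLipschitz

section RadialBoundary

variable {E : Type*} [AddCommGroup E] [Module ℝ E] {Ω : Set E}

/-- The first points outside `Ω` on the half-lines issuing from `0`. For an open starlike `Ω` these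
are the origins of the radial half-lines that make up the complement. -/
def radialBoundary (Ω : Set E) : Set E :=
  {w | w ∉ Ω ∧ ∀ t : ℝ, 0 ≤ t → t < 1 → t • w ∈ Ω}

lemma le_of_smul_eq_smul_of_mem_radialBoundary {w w' : E} (hw : w ∈ radialBoundary Ω)
    (hw' : w' ∈ radialBoundary Ω) {a b : ℝ} (ha : 0 < a) (hb : 0 ≤ b) (h : a • w = b • w') :
    a ≤ b := by
  by_contra! hlt
  have hw_eq : w = (b / a) • w' := by
    rw [div_eq_inv_mul, mul_smul, ← h, inv_smul_smul₀ ha.ne']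
  exact hw.1 (hw_eq ▸ hw'.2 (b / a) (by positivity) ((div_lt_one ha).2 hlt))

lemma eq_of_smul_eq_smul_of_mem_radialBoundary {w w' : E} (hw : w ∈ radialBoundary Ω)
    (hw' : w' ∈ radialBoundary Ω) {a b : ℝ} (ha : 0 < a) (hb : 0 < b) (h : a • w = b • w') :
    w = w' := by
  have hab : a = b := le_antisymm
    (le_of_smul_eq_smul_of_mem_radialBoundary hw hw' ha hb.le h)
    (le_of_smul_eq_smul_of_mem_radialBoundary hw' hw hb ha.le h.symm)
  subst hab
  exact smul_right_injective E ha.ne' h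

lemma exists_mem_radialBoundary_eq_smul [TopologicalSpace E] [ContinuousSMul ℝ E]
    (hΩ : IsOpen Ω) (h0 : (0 : E) ∈ Ω) {u : E} (hu : u ∉ Ω) :
    ∃ w ∈ radialBoundary Ω, ∃ s : ℝ, 1 ≤ s ∧ u = s • w := by
  have hclosed : IsClosed {s : ℝ | s • u ∉ Ω} :=
    (hΩ.preimage (by fun_prop : Continuous fun s : ℝ => s • u)).isClosed_compl
  obtain ⟨s, ⟨⟨hs0, hs1⟩, hsu⟩, hleast⟩ := (isCompact_Icc.inter_right hclosed).exists_isLeast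
    ⟨1, right_mem_Icc.2 zero_le_one, by simpa using hu⟩
  have hs_pos : 0 < s := hs0.lt_of_ne' (by rintro rfl; exact hsu (by simpa using h0))
  refine ⟨s • u, ⟨hsu, fun t ht0 ht1 => ?_⟩, s⁻¹, (one_le_inv₀ hs_pos).2 hs1,
    (inv_smul_smul₀ hs_pos.ne' u).symm⟩
  have hts : t * s < s := mul_lt_of_lt_one_left hs_pos ht1
  by_contra hout
  have hmem : (t * s) • u ∉ Ω := by rwa [mul_smul]
  exact hts.not_ge (hleast ⟨⟨by positivity, hts.le.trans hs1⟩, hmem⟩)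

lemma smul_notMem_of_starConvex (hstar : StarConvex ℝ 0 Ω) {w : E} (hw : w ∉ Ω) {s : ℝ}
    (hs : 1 ≤ s) : s • w ∉ Ω := by
  intro hsw
  have hs_pos : 0 < s := zero_lt_one.trans_le hs
  have hmem := hstar.smul_mem hsw (inv_nonneg.2 hs_pos.le) (inv_le_one_of_one_le₀ hs)
  rw [inv_smul_smul₀ hs_pos.ne'] at hmem
  exact hw hmem

end RadialBoundary

lemma mem_closedHalfLine_self {u w : ℂ} :
    u ∈ closedHalfLine (w, w) ↔ ∃ s : ℝ, 1 ≤ s ∧ u = s • w := by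
  constructor
  · rintro ⟨t, ht, rfl⟩
    exact ⟨1 + t, by linarith, by simp [add_mul]⟩
  · rintro ⟨s, hs, rfl⟩
    exact ⟨s - 1, by linarith, by simp [sub_mul]⟩

lemma exists_eq_smul_of_mem_openHalfLine_self {u w : ℂ} (hu : u ∈ openHalfLine (w, w)) :
    ∃ s : ℝ, 0 < s ∧ u = s • w := by
  obtain ⟨t, ht, rfl⟩ := hu
  exact ⟨1 + t, by linarith, by simp [add_mul]⟩

lemma isCloseToConvexDomain_of_starConvex {Ω : Set ℂ} (hΩ : IsOpen Ω) (hne : Ω.Nonempty)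
    (hstar : StarConvex ℝ 0 Ω) : IsCloseToConvexDomain Ω := by
  have h0 : (0 : ℂ) ∈ Ω := hstar.mem hne
  refine ⟨hΩ, (hstar.isPathConnected h0).isConnected, (fun w => (w, w)) '' radialBoundary Ω,
    ?_, ?_, ?_⟩
  · rintro _ ⟨w, hw, rfl⟩ (rfl : w = 0)
    exact hw.1 h0
  · ext u
    simp only [mem_compl_iff, biUnion_image, mem_iUnion, mem_closedHalfLine_self, exists_prop]
    constructor
    · exact exists_mem_radialBoundary_eq_smul hΩ h0
    · rintro ⟨w, hw, s, hs, rfl⟩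
      exact smul_notMem_of_starConvex hstar hw.1 hs
  · rintro _ ⟨w, hw, rfl⟩ _ ⟨w', hw', rfl⟩ hww'
    refine disjoint_left.2 fun u hu hu' => hww' ?_
    obtain ⟨s, hs, rfl⟩ := exists_eq_smul_of_mem_openHalfLine_self hu
    obtain ⟨s', hs', h⟩ := exists_eq_smul_of_mem_openHalfLine_self hu'
    rw [eq_of_smul_eq_smul_of_mem_radialBoundary hw hw' hs hs' h]

lemma mul_norm_mul_norm_sub_le {E : Type*} [NormedAddCommGroup E] [InnerProductSpace ℝ E]
    {ζ z : E} (hle : ‖z‖ ≤ ‖ζ‖) {t : ℝ} (ht0 : 0 ≤ t) (ht1 : t ≤ 1) :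
    t * ‖z‖ * ‖ζ - z‖ ≤ ‖ζ‖ * ‖ζ - t • z‖ := by
  have hsub : ‖ζ - z‖ ^ 2 = ‖ζ‖ ^ 2 - 2 * inner ℝ ζ z + ‖z‖ ^ 2 := norm_sub_sq_real ζ z
  have hsub_smul : ‖ζ - t • z‖ ^ 2 = ‖ζ‖ ^ 2 - 2 * (t * inner ℝ ζ z) + t ^ 2 * ‖z‖ ^ 2 := by
    rw [norm_sub_sq_real, real_inner_smul_right, norm_smul, mul_pow, Real.norm_of_nonneg ht0]
  have hsq : ‖z‖ ^ 2 ≤ ‖ζ‖ ^ 2 := by gcongr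
  have hfactor₁ : 0 ≤ ‖ζ‖ ^ 2 - t * ‖z‖ ^ 2 := by nlinarith [sq_nonneg ‖z‖]
  have hfactor₂ : 0 ≤ ‖ζ‖ ^ 2 + t * ‖z‖ ^ 2 - 2 * t * inner ℝ ζ z := by
    nlinarith [sq_nonneg ‖ζ - z‖, sq_nonneg ‖ζ‖]
  have hdiff : (‖ζ‖ * ‖ζ - t • z‖) ^ 2 - (t * ‖z‖ * ‖ζ - z‖) ^ 2 =
      (‖ζ‖ ^ 2 - t * ‖z‖ ^ 2) * (‖ζ‖ ^ 2 + t * ‖z‖ ^ 2 - 2 * t * inner ℝ ζ z) := by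
    rw [mul_pow, mul_pow, hsub, hsub_smul]
    ring
  refine le_of_sq_le_sq (sub_nonneg.1 ?_) (by positivity)
  rw [hdiff]
  exact mul_nonneg hfactor₁ hfactor₂

lemma starLipschitzOn_pow_succ {r : ℝ} (hr : 0 ≤ r) (n : ℕ) :
    StarLipschitzOn ((n + 1) * r ^ n) (fun z : ℂ => z ^ (n + 1)) (closedBall 0 r) := by
  intro ζ hζ z hz hle t ht0 ht1
  have hζr : ‖ζ‖ ≤ r := mem_closedBall_zero_iff.1 hζ
  have hzr : ‖z‖ ≤ r := mem_closedBall_zero_iff.1 hz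
  induction n with
  | zero => simp
  | succ n ih =>
    have hsplit : ζ ^ (n + 2) - t • z ^ (n + 2) =
        ζ * (ζ ^ (n + 1) - t • z ^ (n + 1)) + z ^ n * (t • z * (ζ - z)) := by
      simp only [Complex.real_smul]
      ring
    have hchord : ‖t • z * (ζ - z)‖ ≤ r * ‖ζ - t • z‖ := by
      rw [norm_mul, norm_smul, Real.norm_of_nonneg ht0]
      exact (mul_norm_mul_norm_sub_le hle ht0 ht1).trans (by gcongr)
    calc ‖ζ ^ (n + 2) - t • z ^ (n + 2)‖
        ≤ ‖ζ‖ * ‖ζ ^ (n + 1) - t • z ^ (n + 1)‖ + ‖z‖ ^ n * ‖t • z * (ζ - z)‖ := by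
          rw [hsplit, ← norm_pow, ← norm_mul, ← norm_mul]
          exact norm_add_le _ _
      _ ≤ r * ((n + 1) * r ^ n * ‖ζ - t • z‖) + r ^ n * (r * ‖ζ - t • z‖) := by gcongr
      _ = ((n + 1 : ℕ) + 1) * r ^ (n + 1) * ‖ζ - t • z‖ := by
          push_cast
          ring

lemma starLipschitzOn_const_mul_pow_succ {r : ℝ} (hr : 0 ≤ r) (a : ℂ) (n : ℕ) :
    StarLipschitzOn ((n + 1) * ‖a‖ * r ^ n) (fun z : ℂ => a * z ^ (n + 1)) (closedBall 0 r) := by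
  intro ζ hζ z hz hle t ht0 ht1
  calc ‖a * ζ ^ (n + 1) - t • (a * z ^ (n + 1))‖
      = ‖a‖ * ‖ζ ^ (n + 1) - t • z ^ (n + 1)‖ := by
        rw [← norm_mul, mul_sub, mul_smul_comm]
    _ ≤ ‖a‖ * ((n + 1) * r ^ n * ‖ζ - t • z‖) := by
        gcongr
        exact starLipschitzOn_pow_succ hr n hζ hz hle ht0 ht1
    _ = (n + 1) * ‖a‖ * r ^ n * ‖ζ - t • z‖ := by ring

/-- The power series `∑ bₙ zⁿ⁺¹` without constant term. The index is shifted as in `wrightConv`, so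
that `b n` is the coefficient of `zⁿ⁺¹`. -/
noncomputable def shiftedSeries (b : ℕ → ℂ) (z : ℂ) : ℂ := ∑' n : ℕ, b n * z ^ (n + 1)

/-- The majorant `∑ (n + 1) ‖bₙ‖ rⁿ` of the derivative of `shiftedSeries b` on the disk of
radius `r`. -/
noncomputable def derivMajorant (b : ℕ → ℂ) (r : ℝ) : ℝ := ∑' n : ℕ, (n + 1) * ‖b n‖ * r ^ n

lemma shiftedSeries_zero (b : ℕ → ℂ) : shiftedSeries b 0 = 0 := by simp [shiftedSeries]

lemma shiftedSeries_const_mul (a : ℂ) (b : ℕ → ℂ) (z : ℂ) :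
    shiftedSeries (fun n => a * b n) z = a * shiftedSeries b z := by
  simp only [shiftedSeries, mul_assoc, tsum_mul_left]

lemma derivMajorant_nonneg (b : ℕ → ℂ) {r : ℝ} (hr : 0 ≤ r) : 0 ≤ derivMajorant b r :=
  tsum_nonneg fun n => by positivity

lemma isOpen_unitDisk : IsOpen unitDisk := isOpen_ball

lemma zero_mem_unitDisk : (0 : ℂ) ∈ unitDisk := mem_ball_self one_pos

lemma norm_mul_pow_succ_le (a : ℂ) (n : ℕ) {z : ℂ} (hz : ‖z‖ ≤ 1) :
    ‖a * z ^ (n + 1)‖ ≤ (n + 1) * ‖a‖ := by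
  rw [norm_mul, norm_pow, mul_comm]
  gcongr
  linarith [pow_le_one₀ (norm_nonneg z) hz (n := n + 1), Nat.cast_nonneg (α := ℝ) n]

section WeightedSummable

variable {b : ℕ → ℂ} (hb : Summable fun n : ℕ => ((n : ℝ) + 1) * ‖b n‖)

include hb

lemma hasSum_derivMajorant {r : ℝ} (hr0 : 0 ≤ r) (hr1 : r ≤ 1) :
    HasSum (fun n : ℕ => (n + 1) * ‖b n‖ * r ^ n) (derivMajorant b r) :=
  (Summable.of_nonneg_of_le (fun n => by positivity)
    (fun n => mul_le_of_le_one_right (by positivity) (pow_le_one₀ hr0 hr1)) hb).hasSum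

lemma hasSum_shiftedSeries {z : ℂ} (hz : ‖z‖ ≤ 1) :
    HasSum (fun n => b n * z ^ (n + 1)) (shiftedSeries b z) :=
  (Summable.of_norm_bounded hb fun n => norm_mul_pow_succ_le (b n) n hz).hasSum

lemma differentiableOn_shiftedSeries : DifferentiableOn ℂ (shiftedSeries b) unitDisk :=
  Complex.differentiableOn_tsum_of_summable_norm hb (fun n => by fun_prop) isOpen_unitDisk
    fun n _ hz => norm_mul_pow_succ_le (b n) n (mem_ball_zero_iff.1 hz).le

lemma deriv_shiftedSeries_zero : deriv (shiftedSeries b) 0 = b 0 := by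
  have hderiv := Complex.hasSum_deriv_of_summable_norm (F := fun n z => b n * z ^ (n + 1)) hb
    (fun n => by fun_prop) isOpen_unitDisk
    (fun n _ hz => norm_mul_pow_succ_le (b n) n (mem_ball_zero_iff.1 hz).le) zero_mem_unitDisk
  have hsingle : HasSum (fun n => deriv (fun z => b n * z ^ (n + 1)) 0) (b 0) := by
    convert hasSum_ite_eq 0 (b 0) with n
    rcases eq_or_ne n 0 with rfl | hn <;> simp [*]
  exact hderiv.unique hsingle

lemma starLipschitzOn_shiftedSeries {r : ℝ} (hr0 : 0 ≤ r) (hr1 : r ≤ 1) :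
    StarLipschitzOn (derivMajorant b r) (shiftedSeries b) (closedBall 0 r) :=
  .hasSum (fun n => starLipschitzOn_const_mul_pow_succ hr0 (b n) n)
    (hasSum_derivMajorant hb hr0 hr1)
    fun _ hz => hasSum_shiftedSeries hb ((mem_closedBall_zero_iff.1 hz).trans hr1)

lemma one_le_derivMajorant (hb0 : b 0 = 1) {r : ℝ} (hr0 : 0 ≤ r) (hr1 : r ≤ 1) :
    1 ≤ derivMajorant b r := by
  simpa [hb0] using
    le_hasSum (hasSum_derivMajorant hb hr0 hr1) 0 fun n _ => by positivity

lemma starLipschitzOn_shiftedSeries_sub_id (hb0 : b 0 = 1) {r : ℝ} (hr0 : 0 ≤ r) (hr1 : r ≤ 1) :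
    StarLipschitzOn (derivMajorant b r - 1) (fun z => shiftedSeries b z - z) (closedBall 0 r) := by
  refine .hasSum
    (fun n => starLipschitzOn_const_mul_pow_succ hr0 (b (n + 1)) (n + 1)) ?_ fun z hz => ?_
  · simpa [hb0] using (hasSum_nat_add_iff' 1).2 (hasSum_derivMajorant hb hr0 hr1)
  · simpa [hb0] using (hasSum_nat_add_iff' 1).2
      (hasSum_shiftedSeries hb ((mem_closedBall_zero_iff.1 hz).trans hr1))

end WeightedSummable

lemma tsum_mul_pow_lt {d : ℕ → ℝ} (hd : Summable d) (hd_nonneg : ∀ n, 0 ≤ d n) {C : ℝ}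
    (hsum : ∑' n, d n ≤ C) (hd0 : d 0 < C) {r : ℝ} (hr0 : 0 ≤ r) (hr1 : r < 1) :
    ∑' n, d n * r ^ n < C := by
  have hpow : Summable fun n => d n * r ^ n :=
    .of_nonneg_of_le (fun n => mul_nonneg (hd_nonneg n) (pow_nonneg hr0 n))
      (fun n => mul_le_of_le_one_right (hd_nonneg n) (pow_le_one₀ hr0 hr1.le)) hd
  have htail : ∑' n, d (n + 1) * r ^ (n + 1) ≤ (∑' n, d (n + 1)) * r := by
    rw [← tsum_mul_right]
    refine Summable.tsum_le_tsum (fun n => ?_) ((summable_nat_add_iff 1).2 hpow)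
      (((summable_nat_add_iff 1).2 hd).mul_right r)
    exact mul_le_mul_of_nonneg_left (pow_le_of_le_one hr0 hr1.le n.succ_ne_zero) (hd_nonneg _)
  rw [hd.tsum_eq_zero_add] at hsum
  calc ∑' n, d n * r ^ n = d 0 + ∑' n, d (n + 1) * r ^ (n + 1) := by
        rw [hpow.tsum_eq_zero_add, pow_zero, mul_one]
    _ ≤ d 0 + (C - d 0) * r := by
        grw [htail, ← hsum, add_sub_cancel_left]
    _ < C := by nlinarith

/-- The harmonic function with analytic part `∑ cₙ zⁿ⁺¹` and co-analytic part `∑ bₙ zⁿ⁺¹`. -/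
noncomputable def harmonicPowerSeries (c b : ℕ → ℂ) (z : ℂ) : ℂ :=
  shiftedSeries c z + conj (shiftedSeries b z)

section HarmonicPowerSeries

variable {c b : ℕ → ℂ} (hc : Summable fun n : ℕ => ((n : ℝ) + 1) * ‖c n‖)
  (hb : Summable fun n : ℕ => ((n : ℝ) + 1) * ‖b n‖) (hc0 : c 0 = 1) (hb0 : ‖b 0‖ < 1)
  (hcb : ∑' n : ℕ, ((n : ℝ) + 1) * ‖c n‖ + ∑' n : ℕ, ((n : ℝ) + 1) * ‖b n‖ ≤ 2)

include hc hb hc0 hb0 hcb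

lemma derivMajorant_add_lt_two {r : ℝ} (hr0 : 0 ≤ r) (hr1 : r < 1) :
    derivMajorant c r + derivMajorant b r < 2 := by
  have hsum := (hasSum_derivMajorant hc hr0 hr1.le).add (hasSum_derivMajorant hb hr0 hr1.le)
  simp only [← add_mul] at hsum
  rw [← hsum.tsum_eq]
  refine tsum_mul_pow_lt (hc.add hb) (fun n => by positivity) ?_ ?_ hr0 hr1
  · rwa [hc.tsum_add hb]
  · simp only [Nat.cast_zero, zero_add, one_mul, hc0, norm_one]
    linarith

lemma exists_starLipschitzOn_harmonicPowerSeries_sub_id (r : ℝ) (hr0 : 0 ≤ r) (hr1 : r < 1) :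
    ∃ K < 1, StarLipschitzOn K (fun z => harmonicPowerSeries c b z - z) (closedBall 0 r) := by
  refine ⟨derivMajorant c r - 1 + derivMajorant b r, ?_, ?_⟩
  · linarith [derivMajorant_add_lt_two hc hb hc0 hb0 hcb hr0 hr1]
  · simp only [harmonicPowerSeries, add_sub_right_comm]
    exact (starLipschitzOn_shiftedSeries_sub_id hc hc0 hr0 hr1.le).add
      ((starLipschitzOn_shiftedSeries hb hr0 hr1.le).linearIsometry_comp
        Complex.conjLIE.toLinearIsometry)

lemma norm_deriv_shiftedSeries_lt {z : ℂ} (hz : z ∈ unitDisk) :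
    ‖deriv (shiftedSeries b) z‖ < ‖deriv (shiftedSeries c) z‖ := by
  obtain ⟨r, hzr, hr1⟩ := exists_between (mem_ball_zero_iff.1 hz)
  have hr0 : 0 ≤ r := (norm_nonneg z).trans hzr.le
  have hnhds : closedBall 0 r ∈ 𝓝 z := closedBall_mem_nhds_of_mem (mem_ball_zero_iff.2 hzr)
  have hderiv_b : ‖deriv (shiftedSeries b) z‖ ≤ derivMajorant b r := by
    simpa [derivMajorant_nonneg b hr0] using norm_deriv_le_of_lipschitzOn hnhds
      (starLipschitzOn_shiftedSeries hb hr0 hr1.le).lipschitzOnWith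
  have hderiv_c : ‖deriv (shiftedSeries c) z - 1‖ ≤ derivMajorant c r - 1 := by
    have hdiff : DifferentiableAt ℂ (shiftedSeries c) z :=
      (differentiableOn_shiftedSeries hc).differentiableAt (isOpen_unitDisk.mem_nhds hz)
    have hderiv : deriv (fun z => shiftedSeries c z - z) z = deriv (shiftedSeries c) z - 1 :=
      (hdiff.hasDerivAt.sub (hasDerivAt_id z)).deriv
    rw [← hderiv]
    simpa [one_le_derivMajorant hc hc0 hr0 hr1.le] using norm_deriv_le_of_lipschitzOn hnhds
      (starLipschitzOn_shiftedSeries_sub_id hc hc0 hr0 hr1.le).lipschitzOnWith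
  have htriangle : 1 ≤ ‖deriv (shiftedSeries c) z‖ + ‖deriv (shiftedSeries c) z - 1‖ := by
    simpa using norm_sub_le (deriv (shiftedSeries c) z) (deriv (shiftedSeries c) z - 1)
  linarith [derivMajorant_add_lt_two hc hb hc0 hb0 hcb hr0 hr1]

lemma starConvex_image_harmonicPowerSeries :
    StarConvex ℝ 0 (harmonicPowerSeries c b '' unitDisk) :=
  starConvex_image_ball_of_starLipschitzOn_sub_id
    (exists_starLipschitzOn_harmonicPowerSeries_sub_id hc hb hc0 hb0 hcb)

omit hcb in
lemma isNormalizedHarmonic_harmonicPowerSeries :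
    IsNormalizedHarmonic (harmonicPowerSeries c b) (shiftedSeries c) (shiftedSeries b) where
  analytic_h := (differentiableOn_shiftedSeries hc).analyticOnNhd isOpen_unitDisk
  analytic_g := (differentiableOn_shiftedSeries hb).analyticOnNhd isOpen_unitDisk
  h_zero := shiftedSeries_zero c
  deriv_h_zero := (deriv_shiftedSeries_zero hc).trans hc0
  g_zero := shiftedSeries_zero b
  norm_deriv_g_zero := by rwa [deriv_shiftedSeries_zero hb]
  eqOn := fun _ _ => rfl

theorem harmonicPowerSeries_mem_classCH : harmonicPowerSeries c b ∈ ClassCH := by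
  have hstar := exists_starLipschitzOn_harmonicPowerSeries_sub_id hc hb hc0 hb0 hcb
  refine ⟨⟨shiftedSeries c, shiftedSeries b,
    isNormalizedHarmonic_harmonicPowerSeries hc hb hc0 hb0,
    fun z hz => norm_deriv_shiftedSeries_lt hc hb hc0 hb0 hcb hz,
    injOn_ball_of_starLipschitzOn_sub_id hstar⟩, ?_⟩
  exact isCloseToConvexDomain_of_starConvex (isOpen_image_ball_of_starLipschitzOn_sub_id hstar)
    (image_nonempty.2 ⟨0, zero_mem_unitDisk⟩)
    (starConvex_image_harmonicPowerSeries hc hb hc0 hb0 hcb)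

end HarmonicPowerSeries

section GammaLowerBound

lemma rpow_sub_one_mul_exp_neg_le_Gamma_of_one_le {a x : ℝ} (ha : 0 ≤ a) (hx : 1 ≤ x) :
    a ^ (x - 1) * Real.exp (-a) ≤ Real.Gamma x := by
  have hx_pos : 0 < x := zero_lt_one.trans_le hx
  have hconv := Real.GammaIntegral_convergent hx_pos
  have hsub : Ioi a ⊆ Ioi 0 := Ioi_subset_Ioi ha
  calc a ^ (x - 1) * Real.exp (-a) = ∫ t in Ioi a, a ^ (x - 1) * Real.exp (-t) := by
        rw [MeasureTheory.integral_const_mul, integral_exp_neg_Ioi]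
    _ ≤ ∫ t in Ioi a, Real.exp (-t) * t ^ (x - 1) := by
        refine MeasureTheory.setIntegral_mono_on ((integrableOn_exp_neg_Ioi a).const_mul _)
          (hconv.mono_set hsub) measurableSet_Ioi fun t (ht : a < t) => ?_
        rw [mul_comm]
        gcongr
    _ ≤ ∫ t in Ioi (0 : ℝ), Real.exp (-t) * t ^ (x - 1) := by
        refine MeasureTheory.setIntegral_mono_set hconv ?_ hsub.eventuallyLE
        filter_upwards [MeasureTheory.ae_restrict_mem measurableSet_Ioi] with t (ht : 0 < t)
        simp only [Pi.zero_apply]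
        positivity
    _ = Real.Gamma x := (Real.Gamma_eq_integral hx_pos).symm

lemma rpow_sub_one_mul_exp_neg_le_Gamma {a x : ℝ} (ha : 1 ≤ a) (hx : 0 < x) :
    a ^ (x - 1) * Real.exp (-a) ≤ Real.Gamma x := by
  have ha0 : 0 ≤ a := zero_le_one.trans ha
  rcases le_total 1 x with h | h
  · exact rpow_sub_one_mul_exp_neg_le_Gamma_of_one_le ha0 h
  · calc a ^ (x - 1) * Real.exp (-a) ≤ a ^ (x + 1 - 1) * Real.exp (-a) := by gcongr; linarith
      _ ≤ Real.Gamma (x + 1) := rpow_sub_one_mul_exp_neg_le_Gamma_of_one_le ha0 (by linarith)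
      _ = x * Real.Gamma x := Real.Gamma_add_one hx.ne'
      _ ≤ Real.Gamma x := mul_le_of_le_one_left (Real.Gamma_pos_of_pos hx).le h

lemma inv_Gamma_add_natCast_mul_le {a α β : ℝ} (ha : 1 ≤ a) (hα : 0 < α) (hβ : 0 ≤ β) (n : ℕ) :
    (Real.Gamma (α + n * β))⁻¹ ≤ (a ^ (α - 1) * Real.exp (-a))⁻¹ * (a ^ (-β)) ^ n := by
  have ha0 : 0 < a := zero_lt_one.trans_le ha
  calc (Real.Gamma (α + n * β))⁻¹ ≤ (a ^ (α + n * β - 1) * Real.exp (-a))⁻¹ := by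
        gcongr
        exact rpow_sub_one_mul_exp_neg_le_Gamma ha (by positivity)
    _ = (a ^ (α - 1) * Real.exp (-a))⁻¹ * (a ^ (-β)) ^ n := by
        rw [add_sub_right_comm, Real.rpow_add ha0, Real.rpow_neg ha0.le, mul_comm (n : ℝ),
          Real.rpow_mul_natCast ha0.le, inv_pow, ← mul_inv]
        ring

end GammaLowerBound

/-- The Taylor coefficient `Γ(α) Γ(γ) / (Γ(α + nβ) Γ(γ + nδ))` of `zⁿ⁺¹` in the normalized Wright
function. -/
noncomputable def wrightCoeff (α β γ δ : ℝ) (n : ℕ) : ℝ :=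
  Real.Gamma α * Real.Gamma γ / (Real.Gamma (α + n * β) * Real.Gamma (γ + n * δ))

lemma wrightConv_eq_shiftedSeries (α β γ δ : ℝ) (p : ℂ → ℂ) (z : ℂ) :
    wrightConv α β γ δ p z =
      shiftedSeries (fun n => (wrightCoeff α β γ δ n : ℂ) * taylorCoeff p (n + 1)) z := rfl

lemma re_normalizedWright_one (α β γ δ : ℝ) :
    (normalizedWright α β γ δ 1).re = ∑' n, wrightCoeff α β γ δ n := by
  have hcast : normalizedWright α β γ δ 1 = ((∑' n, wrightCoeff α β γ δ n : ℝ) : ℂ) := by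
    rw [normalizedWright, wright, one_mul, ← tsum_mul_left, Complex.ofReal_tsum]
    refine tsum_congr fun n => ?_
    simp only [wrightCoeff, one_pow, mul_one_div]
    push_cast
    rfl
  rw [hcast, Complex.ofReal_re]

section WrightCoeff

variable {α β γ δ : ℝ} (hα : 0 < α) (hγ : 0 < γ)

include hα hγ

lemma wrightCoeff_zero : wrightCoeff α β γ δ 0 = 1 := by
  have hΓ : Real.Gamma α * Real.Gamma γ ≠ 0 :=
    (mul_pos (Real.Gamma_pos_of_pos hα) (Real.Gamma_pos_of_pos hγ)).ne'
  simpa [wrightCoeff] using div_self hΓ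

variable (hβ : 0 ≤ β) (hδ : 0 ≤ δ)

include hβ hδ

lemma wrightCoeff_nonneg (n : ℕ) : 0 ≤ wrightCoeff α β γ δ n := by
  unfold wrightCoeff
  positivity

lemma summable_wrightCoeff (hβδ : 0 < β + δ) : Summable (wrightCoeff α β γ δ) := by
  have hratio : (2 : ℝ) ^ (-β) * 2 ^ (-δ) < 1 := by
    rw [← Real.rpow_add two_pos]
    exact Real.rpow_lt_one_of_one_lt_of_neg one_lt_two (by linarith)
  have hgeom := (summable_geometric_of_lt_one (by positivity) hratio).mul_left
    (Real.Gamma α * Real.Gamma γ *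
      ((2 ^ (α - 1) * Real.exp (-2))⁻¹ * (2 ^ (γ - 1) * Real.exp (-2))⁻¹))
  refine .of_nonneg_of_le (wrightCoeff_nonneg hα hγ hβ hδ) (fun n => ?_) hgeom
  calc wrightCoeff α β γ δ n
      = Real.Gamma α * Real.Gamma γ *
          ((Real.Gamma (α + n * β))⁻¹ * (Real.Gamma (γ + n * δ))⁻¹) := by
        rw [wrightCoeff, div_eq_mul_inv, mul_inv]
    _ ≤ Real.Gamma α * Real.Gamma γ *
          ((2 ^ (α - 1) * Real.exp (-2))⁻¹ * (2 ^ (-β)) ^ n *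
            ((2 ^ (γ - 1) * Real.exp (-2))⁻¹ * (2 ^ (-δ)) ^ n)) := by
        gcongr
        · exact inv_Gamma_add_natCast_mul_le one_le_two hα hβ n
        · exact inv_Gamma_add_natCast_mul_le one_le_two hγ hδ n
    _ = _ := by ring

end WrightCoeff

section WeightedMultiplier

variable {v a : ℕ → ℂ} (hv : Summable fun n => ‖v n‖)
  (ha : ∀ n : ℕ, ((n : ℝ) + 1) * ‖a n‖ ≤ 1)

include ha in
lemma weighted_norm_mul_le (n : ℕ) : ((n : ℝ) + 1) * ‖v n * a n‖ ≤ ‖v n‖ := by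
  rw [norm_mul, mul_left_comm]
  exact mul_le_of_le_one_right (norm_nonneg _) (ha n)

include hv ha

lemma summable_weighted_norm_mul : Summable fun n : ℕ => ((n : ℝ) + 1) * ‖v n * a n‖ :=
  .of_nonneg_of_le (fun n => by positivity) (weighted_norm_mul_le ha) hv

lemma tsum_weighted_norm_mul_le :
    ∑' n : ℕ, ((n : ℝ) + 1) * ‖v n * a n‖ ≤ ∑' n, ‖v n‖ - ‖v 0‖ + ‖v 0 * a 0‖ := by
  have hva := summable_weighted_norm_mul hv ha
  have htail := ((summable_nat_add_iff 1).2 hva).tsum_le_tsum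
    (fun n => weighted_norm_mul_le ha (n + 1)) ((summable_nat_add_iff 1).2 hv)
  rw [hva.tsum_eq_zero_add, hv.tsum_eq_zero_add, Nat.cast_zero, zero_add, one_mul]
  linarith

end WeightedMultiplier

section WrightMultiplier

variable {α β γ δ : ℝ} (hα : 0 < α) (hγ : 0 < γ) (hβ : 0 ≤ β) (hδ : 0 ≤ δ) (hβδ : 0 < β + δ)
  {a : ℕ → ℂ} (ha : ∀ n : ℕ, ((n : ℝ) + 1) * ‖a n‖ ≤ 1)

include hα hγ hβ hδ

lemma norm_wrightCoeff (n : ℕ) : ‖(wrightCoeff α β γ δ n : ℂ)‖ = wrightCoeff α β γ δ n :=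
  Complex.norm_of_nonneg (wrightCoeff_nonneg hα hγ hβ hδ n)

include hβδ

lemma summable_norm_wrightCoeff : Summable fun n => ‖(wrightCoeff α β γ δ n : ℂ)‖ :=
  (summable_wrightCoeff hα hγ hβ hδ hβδ).congr fun n => (norm_wrightCoeff hα hγ hβ hδ n).symm

include ha

lemma summable_weighted_wrightCoeff_mul :
    Summable fun n : ℕ => ((n : ℝ) + 1) * ‖(wrightCoeff α β γ δ n : ℂ) * a n‖ :=
  summable_weighted_norm_mul (summable_norm_wrightCoeff hα hγ hβ hδ hβδ) ha

lemma tsum_weighted_wrightCoeff_mul_le :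
    ∑' n : ℕ, ((n : ℝ) + 1) * ‖(wrightCoeff α β γ δ n : ℂ) * a n‖ ≤
      (normalizedWright α β γ δ 1).re - 1 + ‖a 0‖ := by
  have hle := tsum_weighted_norm_mul_le (summable_norm_wrightCoeff hα hγ hβ hδ hβδ) ha
  simpa only [norm_wrightCoeff hα hγ hβ hδ, wrightCoeff_zero hα hγ, Complex.ofReal_one, norm_one,
    one_mul, ← re_normalizedWright_one] using hle

end WrightMultiplier

lemma taylorCoeff_one (p : ℂ → ℂ) : taylorCoeff p 1 = deriv p 0 := by
  simp [taylorCoeff, iteratedDeriv_one]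

lemma wrightOperator_one (α₁ β₁ γ₁ δ₁ α₂ β₂ γ₂ δ₂ : ℝ) (h g : ℂ → ℂ) :
    wrightOperator α₁ β₁ γ₁ δ₁ α₂ β₂ γ₂ δ₂ 1 h g =
      fun z => wrightConv α₁ β₁ γ₁ δ₁ h z + conj (wrightConv α₂ β₂ γ₂ δ₂ g z) :=
  funext fun z => by rw [wrightOperator, one_mul]

lemma wrightOperator_eq_harmonicPowerSeries (α₁ β₁ γ₁ δ₁ α₂ β₂ γ₂ δ₂ : ℝ) (σ : ℂ)
    (h g : ℂ → ℂ) :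
    wrightOperator α₁ β₁ γ₁ δ₁ α₂ β₂ γ₂ δ₂ σ h g =
      harmonicPowerSeries (fun n => (wrightCoeff α₁ β₁ γ₁ δ₁ n : ℂ) * taylorCoeff h (n + 1))
        (fun n => (wrightCoeff α₂ β₂ γ₂ δ₂ n : ℂ) * (σ * taylorCoeff g (n + 1))) :=
  funext fun z => by
    simp only [wrightOperator, harmonicPowerSeries, wrightConv_eq_shiftedSeries,
      mul_left_comm _ σ, shiftedSeries_const_mul]

lemma le_of_tsum_add_tsum_le {ι κ : Type*} {x : ι → ℝ} {y : κ → ℝ} {C : ℝ} (hx : Summable x)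
    (hx0 : ∀ i, 0 ≤ x i) (hy0 : ∀ k, 0 ≤ y k) (hxy : ∑' i, x i + ∑' k, y k ≤ C) (i : ι) :
    x i ≤ C :=
  (hx.le_tsum i fun j _ => hx0 j).trans ((le_add_of_nonneg_right (tsum_nonneg hy0)).trans hxy)

theorem mainTheorem7_general
    {α₁ β₁ γ₁ δ₁ α₂ β₂ γ₂ δ₂ : ℝ}
    (hα₁ : 0 < α₁) (hγ₁ : 0 < γ₁) (hα₂ : 0 < α₂) (hγ₂ : 0 < γ₂)
    (hβ₁ : 0 ≤ β₁) (hδ₁ : 0 ≤ δ₁) (hβ₂ : 0 ≤ β₂) (hδ₂ : 0 ≤ δ₂)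
    (hβδ₁ : 0 < β₁ + δ₁) (hβδ₂ : 0 < β₂ + δ₂)
    {σ : ℂ} (hσ : ‖σ‖ ≤ 1)
    {f h g : ℂ → ℂ} (hf : IsNormalizedHarmonic f h g)
    (hA : ∀ n : ℕ, ((n : ℝ) + 2) * ‖taylorCoeff h (n + 2)‖ ≤ 1)
    (hB : ∀ n : ℕ, ((n : ℝ) + 1) * ‖taylorCoeff g (n + 1)‖ ≤ 1)
    (hW : (normalizedWright α₁ β₁ γ₁ δ₁ 1).re + (normalizedWright α₂ β₂ γ₂ δ₂ 1).re - 2 ≤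
      1 - ‖taylorCoeff g 1‖) :
    wrightOperator α₁ β₁ γ₁ δ₁ α₂ β₂ γ₂ δ₂ σ h g ∈ ClassCH ∧
      StarConvex ℝ 0 (wrightOperator α₁ β₁ γ₁ δ₁ α₂ β₂ γ₂ δ₂ σ h g '' unitDisk) := by
  have hA₁ : taylorCoeff h 1 = 1 := (taylorCoeff_one h).trans hf.deriv_h_zero
  have hB₁ : ‖taylorCoeff g 1‖ < 1 := by simpa only [taylorCoeff_one] using hf.norm_deriv_g_zero
  have hσB : ∀ n, ‖σ * taylorCoeff g n‖ ≤ ‖taylorCoeff g n‖ := fun n => by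
    simpa only [norm_mul] using mul_le_of_le_one_left (norm_nonneg _) hσ
  have ha : ∀ n : ℕ, ((n : ℝ) + 1) * ‖taylorCoeff h (n + 1)‖ ≤ 1
    | 0 => by simp [hA₁]
    | n + 1 => by simpa [add_assoc, one_add_one_eq_two] using hA n
  have hb : ∀ n : ℕ, ((n : ℝ) + 1) * ‖σ * taylorCoeff g (n + 1)‖ ≤ 1 := fun n =>
    (mul_le_mul_of_nonneg_left (hσB _) (by positivity)).trans (hB n)
  have hsummable_c := summable_weighted_wrightCoeff_mul hα₁ hγ₁ hβ₁ hδ₁ hβδ₁ ha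
  have hsummable_b := summable_weighted_wrightCoeff_mul hα₂ hγ₂ hβ₂ hδ₂ hβδ₂ hb
  have hsum_c := tsum_weighted_wrightCoeff_mul_le hα₁ hγ₁ hβ₁ hδ₁ hβδ₁ ha
  have hsum_b := tsum_weighted_wrightCoeff_mul_le hα₂ hγ₂ hβ₂ hδ₂ hβδ₂ hb
  rw [zero_add, hA₁, norm_one] at hsum_c
  rw [zero_add] at hsum_b
  have hc0 : (wrightCoeff α₁ β₁ γ₁ δ₁ 0 : ℂ) * taylorCoeff h (0 + 1) = 1 := by
    simp [wrightCoeff_zero hα₁ hγ₁, hA₁]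
  have hb0 : ‖(wrightCoeff α₂ β₂ γ₂ δ₂ 0 : ℂ) * (σ * taylorCoeff g (0 + 1))‖ < 1 := by
    rw [wrightCoeff_zero hα₂ hγ₂, Complex.ofReal_one, one_mul, zero_add]
    exact (hσB 1).trans_lt hB₁
  rw [wrightOperator_eq_harmonicPowerSeries]
  have hsum := (add_le_add hsum_c hsum_b).trans (c := 2) (by linarith [hσB 1])
  exact ⟨harmonicPowerSeries_mem_classCH hsummable_c hsummable_b hc0 hb0 hsum,
    starConvex_image_harmonicPowerSeries hsummable_c hsummable_b hc0 hb0 hsum⟩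

theorem mainTheorem7
    (α₁ β₁ γ₁ δ₁ α₂ β₂ γ₂ δ₂ : ℝ)
    (hα₁ : 0 < α₁) (hγ₁ : 0 < γ₁) (hα₂ : 0 < α₂) (hγ₂ : 0 < γ₂)
    (hβ₁ : 0 ≤ β₁) (hδ₁ : 0 ≤ δ₁) (hβ₂ : 0 ≤ β₂) (hδ₂ : 0 ≤ δ₂)
    -- the Wright series converge at `1` (otherwise `W₁(1)`, `W₂(1)` are meaningless)
    (hβδ₁ : 0 < β₁ + δ₁) (hβδ₂ : 0 < β₂ + δ₂)
    (σ : ℂ) (hσ : ‖σ‖ < 1)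
    (f h g : ℂ → ℂ) (hf : IsNormalizedHarmonic f h g)
    (hA : Summable fun n : ℕ => ((n : ℝ) + 2) * ‖taylorCoeff h (n + 2)‖)
    (hB : Summable fun n : ℕ => ((n : ℝ) + 1) * ‖taylorCoeff g (n + 1)‖)
    (hAB : (∑' n : ℕ, ((n : ℝ) + 2) * ‖taylorCoeff h (n + 2)‖) +
      (∑' n : ℕ, ((n : ℝ) + 1) * ‖taylorCoeff g (n + 1)‖) ≤ 1)
    (hW : (normalizedWright α₁ β₁ γ₁ δ₁ 1).re + (normalizedWright α₂ β₂ γ₂ δ₂ 1).re - 2 ≤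
      1 - ‖taylorCoeff g 1‖) :
    wrightOperator α₁ β₁ γ₁ δ₁ α₂ β₂ γ₂ δ₂ σ h g ∈ ClassCH ∧
      (fun z => wrightConv α₁ β₁ γ₁ δ₁ h z + conj (wrightConv α₂ β₂ γ₂ δ₂ g z)) ∈ ClassCH := by
  have hA0 (n : ℕ) : 0 ≤ ((n : ℝ) + 2) * ‖taylorCoeff h (n + 2)‖ := by positivity
  have hB0 (n : ℕ) : 0 ≤ ((n : ℝ) + 1) * ‖taylorCoeff g (n + 1)‖ := by positivity
  have hA_le := le_of_tsum_add_tsum_le hA hA0 hB0 hAB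
  have hB_le := le_of_tsum_add_tsum_le hB hB0 hA0 ((add_comm _ _).trans_le hAB)
  have hmem {τ : ℂ} (hτ : ‖τ‖ ≤ 1) : wrightOperator α₁ β₁ γ₁ δ₁ α₂ β₂ γ₂ δ₂ τ h g ∈ ClassCH :=
    (mainTheorem7_general hα₁ hγ₁ hα₂ hγ₂ hβ₁ hδ₁ hβ₂ hδ₂ hβδ₁ hβδ₂ hτ hf hA_le hB_le hW).1
  exact ⟨hmem hσ.le, by simpa only [wrightOperator_one] using hmem norm_one.le⟩
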